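/- **Interpolation theorem for quantum $L^p$-spaces.** Let $n\in\mathbb N$, $H=L^2(\mathbb R^n)$. For $1\le p<\infty$ and a compact operator $A$ on $H$ with singular values $s_k(A)$ (the eigenvalues of $|A|=(A^*A)^{1/2}$, repeated according to multiplicity) put $\|A\|_{T^p}=\bigl(\sum_k s_k(A)^p\bigr)^{1/p}\in[0,\infty]$, and let $\|A\|_{T^\infty}$ be the operator norm; let $T^1(H)$ be the space of trace-class operators, i.e. the compact operators $A$ with $\|A\|_{T^1}<\infty$. For $1\le p\le\infty$ put $$L^p_{\mathrm{QHA}}=\bigl\{(f,A)\in L^1(\mathbb R^{2n})\oplus T^1(H):\ \|(f,A)\|_{L^p}:=\|f\|_{L^p(\mathbb R^{2n})}+\|A\|_{T^p}<\infty\bigr\}.$$ Let $1\le p_0<p_1\le\infty$, $0<\theta<1$, and let $p_\theta$ be given by $$\frac1{p_\theta}=\frac{1-\theta}{p_0}+\frac{\theta}{p_1}\qquad(1/\infty=0).$$ Then for every $(f,A)\in L^{p_0}_{\mathrm{QHA}}\cap L^{p_1}_{\mathrm{QHA}}$, $$\|(f,A)\|_{L^{p_\theta}}\le\|(f,A)\|_{L^{p_0}}^{1-\theta}\,\|(f,A)\|_{L^{p_1}}^{\theta}.$$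 -/

import Mathlib

open MeasureTheory
open scoped ENNReal

noncomputable section

namespace QHA

section Schatten

variable {H : Type*} [NormedAddCommGroup H] [InnerProductSpace ℂ H] [CompleteSpace H]

/-- The multiplicity of `s` as a singular value of `A`: the dimension (possibly `∞`) of the
eigenspace `ker (|A| - s)`, where `|A| = (A* A)^(1/2)`. -/
def singularMultiplicity (A : H →L[ℂ] H) (s : ℝ) : ℕ∞ :=
  Cardinal.toENat (Module.rank ℂ
    (Module.End.eigenspace ((CFC.abs A : H →L[ℂ] H) : H →ₗ[ℂ] H) (s : ℂ)))

/-- The Schatten norm `‖A‖_{T^p}` of a compact operator `A`, with values in `[0, ∞]`: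
for `p < ∞` it is `(∑ s^p)^(1/p)`, the sum running over the nonzero singular values of `A`
(the positive eigenvalues of `|A|`) repeated according to multiplicity;
for `p = ∞` it is the operator norm. -/
def schattenENorm (p : ℝ≥0∞) (A : H →L[ℂ] H) : ℝ≥0∞ :=
  if p = ∞ then ‖A‖ₑ
  else (∑' s : Set.Ioi (0 : ℝ),
    (singularMultiplicity A s : ℝ≥0∞) * ENNReal.ofReal (s : ℝ) ^ p.toReal) ^ (1 / p.toReal)

/-- The Schatten class `T^p(H)`: the compact operators with finite Schatten `p`-norm. -/
def schattenClass (H : Type*) [NormedAddCommGroup H] [InnerProductSpace ℂ H] [CompleteSpace H]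
    (p : ℝ≥0∞) : Set (H →L[ℂ] H) :=
  {A | IsCompactOperator A ∧ schattenENorm p A < ∞}

end Schatten

/-- The Hilbert space `H = L²(ℝⁿ)`. -/
abbrev L2 (n : ℕ) : Type := Lp ℂ 2 (volume : Measure (EuclideanSpace ℝ (Fin n)))

/-- The space `L¹(ℝ²ⁿ)`. -/
abbrev L1Phase (n : ℕ) : Type := Lp ℂ 1 (volume : Measure (EuclideanSpace ℝ (Fin (2 * n))))

/-- `‖(f, A)‖_p = ‖f‖_{L^p} + ‖A‖_{T^p}`, with values in `[0, ∞]`. -/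
def qhaENorm {n : ℕ} (p : ℝ≥0∞) (x : L1Phase n × (L2 n →L[ℂ] L2 n)) : ℝ≥0∞ :=
  eLpNorm x.1 p volume + schattenENorm p x.2

/-- The quantum `L^p`-space: the pairs `(f, A)` in `L¹(ℝ²ⁿ) ⊕ T¹(L²(ℝⁿ))` with
`‖(f, A)‖_p < ∞`. -/
def qhaSpace (n : ℕ) (p : ℝ≥0∞) : Set (L1Phase n × (L2 n →L[ℂ] L2 n)) :=
  {x | x.2 ∈ schattenClass (L2 n) 1 ∧ qhaENorm p x < ∞}

end QHA

end

open MeasureTheory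
open scoped ENNReal

namespace QHA

/-! Both summands are `L^p` norms: the Schatten norm of `A` is that of the identity function on `(0,
∞)` for the measure counting singular values. Hölder applied to `|f| = |f|^(1-θ) |f|^θ` makes each
summand log-convex in `1/p`, and Hölder on two points recombines the sums. -/

/-- **Lyapunov's inequality**: the `L^p` seminorms are log-convex in `1 / p`. -/
theorem eLpNorm_le_rpow_mul_rpow {α E : Type*} [MeasurableSpace α] {μ : Measure α}
    [NormedAddCommGroup E] {f : α → E} (hf : AEStronglyMeasurable f μ) {p₀ p₁ pθ : ℝ≥0∞} {θ : ℝ}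
    (hθ₀ : 0 < θ) (hθ₁ : θ < 1)
    (hpθ : 1 / pθ = ENNReal.ofReal (1 - θ) / p₀ + ENNReal.ofReal θ / p₁) :
    eLpNorm f pθ μ ≤ eLpNorm f p₀ μ ^ (1 - θ) * eLpNorm f p₁ μ ^ θ := by
  have hθ' : 0 < 1 - θ := sub_pos.2 hθ₁
  have ofReal_ne_zero {t : ℝ} (ht : 0 < t) : ENNReal.ofReal t ≠ 0 := by simpa using ht
  have hmul (p : ℝ≥0∞) {t : ℝ} (ht : 0 < t) :
      p / ENNReal.ofReal t * ENNReal.ofReal t = p :=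
    ENNReal.div_mul_cancel (ofReal_ne_zero ht) ENNReal.ofReal_ne_top
  have hinv (p : ℝ≥0∞) {t : ℝ} (ht : 0 < t) :
      (p / ENNReal.ofReal t)⁻¹ = ENNReal.ofReal t / p :=
    ENNReal.inv_div (.inl ENNReal.ofReal_ne_top) (.inl (ofReal_ne_zero ht))
  -- `hpθ` is exactly the Hölder relation for these exponents.
  have : ENNReal.HolderTriple (p₀ / ENNReal.ofReal (1 - θ)) (p₁ / ENNReal.ofReal θ) pθ :=
    ⟨by rw [hinv _ hθ', hinv _ hθ₀, ← hpθ, one_div]⟩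
  have hmeas {t : ℝ} (ht : 0 < t) : AEStronglyMeasurable (fun x ↦ ‖f x‖ ^ t) μ :=
    (Real.continuous_rpow_const ht.le).comp_aestronglyMeasurable hf.norm
  have key := eLpNorm_smul_le_mul_eLpNorm (p := p₀ / ENNReal.ofReal (1 - θ))
    (q := p₁ / ENNReal.ofReal θ) (r := pθ) (hmeas hθ₀) (hmeas hθ')
  rw [eLpNorm_norm_rpow f hθ', eLpNorm_norm_rpow f hθ₀, hmul _ hθ', hmul _ hθ₀] at key
  convert! key using 1
  rw [← eLpNorm_norm f]
  congr 1
  funext x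
  rw [Pi.smul_apply', smul_eq_mul, ← Real.rpow_add_of_nonneg (norm_nonneg _) hθ'.le hθ₀.le]
  simp

/-- Hölder's inequality for sums of two terms. -/
theorem rpow_mul_rpow_add_le {θ : ℝ} (hθ₀ : 0 < θ) (hθ₁ : θ < 1) (a₀ a₁ b₀ b₁ : ℝ≥0∞) :
    a₀ ^ (1 - θ) * a₁ ^ θ + b₀ ^ (1 - θ) * b₁ ^ θ ≤ (a₀ + b₀) ^ (1 - θ) * (a₁ + b₁) ^ θ := by
  have h := ENNReal.lintegral_mul_norm_pow_le (μ := Measure.count (α := Bool))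
    (f := fun i ↦ bif i then a₀ else b₀) (g := fun i ↦ bif i then a₁ else b₁)
    (measurable_of_finite _).aemeasurable (measurable_of_finite _).aemeasurable
    (sub_nonneg.2 hθ₁.le) hθ₀.le (sub_add_cancel 1 θ)
  simpa [lintegral_count] using h

section Schatten

variable {H : Type*} [NormedAddCommGroup H] [InnerProductSpace ℂ H] [CompleteSpace H]

/-- The singular values of `A` are bounded by its norm. -/
theorem le_norm_of_singularMultiplicity_ne_zero {A : H →L[ℂ] H} {s : ℝ}
    (h : singularMultiplicity A s ≠ 0) : s ≤ ‖A‖ := by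
  obtain ⟨v, hv, hv0⟩ := Submodule.exists_mem_ne_zero_of_ne_bot
    (p := Module.End.eigenspace ((CFC.abs A : H →L[ℂ] H) : H →ₗ[ℂ] H) (s : ℂ)) <| by
      intro hbot
      apply h
      rw [singularMultiplicity, hbot]
      simp
  have hv : CFC.abs A v = (s : ℂ) • v := Module.End.mem_eigenspace_iff.1 hv
  have hle := (CFC.abs A).le_opNorm v
  rw [hv, norm_smul, CFC.norm_abs] at hle
  have := le_of_mul_le_mul_right hle (norm_pos_iff.2 hv0)
  exact (Real.le_norm_self s).trans (by simpa using this)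

/-- The distribution of the singular values of `A`, counted with multiplicity. -/
noncomputable def singularMeasure (A : H →L[ℂ] H) : Measure (Set.Ioi (0 : ℝ)) :=
  Measure.sum fun s : Set.Ioi (0 : ℝ) ↦ (singularMultiplicity A s : ℝ≥0∞) • Measure.dirac s

theorem lintegral_singularMeasure (A : H →L[ℂ] H) {g : Set.Ioi (0 : ℝ) → ℝ≥0∞} :
    ∫⁻ s, g s ∂singularMeasure A = ∑' s : Set.Ioi (0 : ℝ),
      (singularMultiplicity A s : ℝ≥0∞) * g s := by
  simp [singularMeasure, lintegral_sum_measure, lintegral_smul_measure, lintegral_dirac]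

theorem schattenENorm_eq_eLpNorm (A : H →L[ℂ] H) {p : ℝ≥0∞} (hp₀ : p ≠ 0) (hp : p ≠ ∞) :
    schattenENorm p A = eLpNorm (Subtype.val : Set.Ioi (0 : ℝ) → ℝ) p (singularMeasure A) := by
  rw [schattenENorm, if_neg hp, eLpNorm_eq_lintegral_rpow_enorm_toReal hp₀ hp,
    lintegral_singularMeasure]
  simp_rw [fun s : Set.Ioi (0 : ℝ) ↦ Real.enorm_eq_ofReal s.2.le]

/-- At `p = ∞` only `≤` is claimed: without compactness `‖A‖` may exceed every eigenvalue of `|A|`.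
This suffices, since equality is needed only at the finite exponent `pθ`. -/
theorem eLpNorm_singularMeasure_le_schattenENorm (A : H →L[ℂ] H) {p : ℝ≥0∞} (hp₀ : p ≠ 0) :
    eLpNorm (Subtype.val : Set.Ioi (0 : ℝ) → ℝ) p (singularMeasure A) ≤ schattenENorm p A := by
  rcases eq_or_ne p ∞ with rfl | hp
  · rw [schattenENorm, if_pos rfl, eLpNorm_exponent_top]
    refine essSup_le_of_ae_le _ ?_
    rw [Filter.EventuallyLE, ae_iff, ← lintegral_indicator_one₀, lintegral_singularMeasure,
      ENNReal.tsum_eq_zero]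
    · intro s
      by_cases hs : singularMultiplicity A s = 0
      · simp [hs]
      have hle := le_norm_of_singularMultiplicity_ne_zero hs
      have : ‖(s : ℝ)‖ₑ ≤ ‖A‖ₑ := by
        rw [Real.enorm_eq_ofReal s.2.le, ← ofReal_norm]
        exact ENNReal.ofReal_le_ofReal hle
      simp [this]
    · exact (measurableSet_le measurable_subtype_coe.enorm measurable_const).compl.nullMeasurableSet
  · exact (schattenENorm_eq_eLpNorm A hp₀ hp).ge

/-- The Schatten norms are log-convex in `1 / p`. -/
theorem schattenENorm_le_rpow_mul_rpow (A : H →L[ℂ] H) {p₀ p₁ pθ : ℝ≥0∞} {θ : ℝ}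
    (hp₀ : p₀ ≠ 0) (hp₁ : p₁ ≠ 0) (hpθ₀ : pθ ≠ 0) (hpθ₁ : pθ ≠ ∞) (hθ₀ : 0 < θ) (hθ₁ : θ < 1)
    (hpθ : 1 / pθ = ENNReal.ofReal (1 - θ) / p₀ + ENNReal.ofReal θ / p₁) :
    schattenENorm pθ A ≤ schattenENorm p₀ A ^ (1 - θ) * schattenENorm p₁ A ^ θ := by
  rw [schattenENorm_eq_eLpNorm A hpθ₀ hpθ₁]
  refine (eLpNorm_le_rpow_mul_rpow measurable_subtype_coe.aestronglyMeasurable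
    hθ₀ hθ₁ hpθ).trans ?_
  have := sub_nonneg.2 hθ₁.le
  gcongr
  · exact eLpNorm_singularMeasure_le_schattenENorm A hp₀
  · exact eLpNorm_singularMeasure_le_schattenENorm A hp₁

end Schatten

end QHA

theorem mainTheorem1 (n : ℕ) (p₀ p₁ pθ : ℝ≥0∞) (θ : ℝ)
    (hp₀ : 1 ≤ p₀) (hp : p₀ < p₁) (hθ₀ : 0 < θ) (hθ₁ : θ < 1)
    (hpθ : 1 / pθ = ENNReal.ofReal (1 - θ) / p₀ + ENNReal.ofReal θ / p₁)
    (f : QHA.L1Phase n) (A : QHA.L2 n →L[ℂ] QHA.L2 n)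
    (h₀ : (f, A) ∈ QHA.qhaSpace n p₀) (h₁ : (f, A) ∈ QHA.qhaSpace n p₁) :
    QHA.qhaENorm pθ (f, A) ≤
      QHA.qhaENorm p₀ (f, A) ^ (1 - θ) * QHA.qhaENorm p₁ (f, A) ^ θ := by
  have hp₀' : p₀ ≠ 0 := (zero_lt_one.trans_le hp₀).ne'
  have hp₁' : p₁ ≠ 0 := hp.ne_bot
  have hpθ₀ : pθ ≠ 0 := by
    rintro rfl
    have : ENNReal.ofReal (1 - θ) / p₀ + ENNReal.ofReal θ / p₁ ≠ ∞ :=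
      ENNReal.add_ne_top.2 ⟨ENNReal.div_ne_top ENNReal.ofReal_ne_top hp₀',
        ENNReal.div_ne_top ENNReal.ofReal_ne_top hp₁'⟩
    exact this (by rw [← hpθ]; simp)
  -- `p₀ < p₁` forces `p₀ < ∞`, so `1 / pθ` has a positive summand.
  have hpθ₁ : pθ ≠ ∞ := by
    rintro rfl
    have h : ENNReal.ofReal (1 - θ) / p₀ = 0 := by
      refine (add_eq_zero.1 (hpθ.symm.trans ?_)).1
      simp
    rcases ENNReal.div_eq_zero_iff.1 h with h | h
    · exact absurd (ENNReal.ofReal_eq_zero.1 h) (by linarith)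
    · exact hp.ne_top h
  refine (add_le_add
    (QHA.eLpNorm_le_rpow_mul_rpow (Lp.aestronglyMeasurable f) hθ₀ hθ₁ hpθ)
    (QHA.schattenENorm_le_rpow_mul_rpow A hp₀' hp₁' hpθ₀ hpθ₁ hθ₀ hθ₁ hpθ)).trans ?_
  exact QHA.rpow_mul_rpow_add_le hθ₀ hθ₁ _ _ _ _
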